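/- Let $\mathcal H=\bigotimes_{j=1}^m\mathcal H_j$ be a multipartite Hilbert space with $\dim\mathcal H_j=d_j$, $1\le d_j<\infty$, let $c$ be a positive integer and $n$ a non-negative integer. Let $\mu$ be the uniform probability measure on the projective space $\operatorname{P}(\mathcal H)$ of pure states, i.e. the law of $U\psi_0$ for a fixed state $\psi_0$ and a Haar-random unitary $U$ of $\mathcal H$; "almost all sets of $n$ pure states" means almost all $(\psi_1,\dots,\psi_n)\in\operatorname{P}(\mathcal H)^n$ with respect to the product measure $\mu\times\dots\times\mu$. Say that pure states $\psi_1,\dots,\psi_n$ of $\mathcal H$ are unambiguously locally distinguishable given $c$ separated copies if there is a POVM $\{E_k\}_{k=0,\dots,n}$ on $\mathcal H^{\otimes c}$, implementable by a finite protocol of local operations and classical communication between $cm$ parties (one for each subsystem of each copy), such that for all $j,k\in\{1,\dots,n\}$ $$\langle\psi_j^{\otimes c}|E_k|\psi_j^{\otimes c}\rangle=0\quad\text{if and only if}\quad j\ne k .$$ Then almost all sets of $n$ pure states of $\mathcal H$ are unambiguously locally distinguishable given $c$ separated copies if and only if $$n\le 1+c\sum_j(d_j-1).$$ Moreover, if $n>1+c\sum_j(d_j-1)$,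 then almost all sets of $n$ pure states of $\mathcal H$ are not unambiguously locally distinguishable given $c$ separated copies. -/

import Mathlib

open MeasureTheory Matrix
open scoped LinearAlgebra.Projectivization ComplexOrder

noncomputable section

namespace Multipartite

/-! ### Multipartite Hilbert spaces and pure states -/

section States

variable {ι : Type*}

/-- The multipartite Hilbert space `⨂ j, ℂ^(d j)`, written in its product basis
`|x₁⟩ ⊗ |x₂⟩ ⊗ ⋯`, which is indexed by the tuples `x` with `x j < d j`. -/
abbrev HilbertSpace (d : ι → ℕ) : Type _ := EuclideanSpace ℂ (∀ j, Fin (d j))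

/-- The vector `v^{⊗c}` in `(⨂ j, ℂ^(d j))^{⊗c}`. The latter is the Hilbert space of the parties
`(i, j)`, where `(i, j)` holds the `j`-th subsystem of the `i`-th copy. -/
def tensorPower {d : ι → ℕ} (c : ℕ) (v : HilbertSpace d) :
    HilbertSpace (fun p : Fin c × ι => d p.2) :=
  WithLp.toLp 2 fun x => ∏ i : Fin c, v fun j => x (i, j)

theorem tensorPower_ne_zero {d : ι → ℕ} (c : ℕ) {v : HilbertSpace d} (hv : v ≠ 0) :
    tensorPower c v ≠ 0 := by
  intro h
  apply hv
  ext x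
  have := congrArg (fun w : HilbertSpace (fun p : Fin c × ι => d p.2) => w fun p => x p.2) h
  simp only [tensorPower, Finset.prod_const, PiLp.zero_apply] at this
  simpa using eq_zero_of_pow_eq_zero this

/-- Pure states: points of the projective space of the Hilbert space. -/
abbrev PureState (d : ι → ℕ) : Type _ := ℙ ℂ (HilbertSpace d)

/-- The state `ψ^{⊗c}` of `c` separated copies, as a state shared by the parties `(i, j)`. -/
def PureState.separatedCopies {d : ι → ℕ} (c : ℕ) (ψ : PureState d) :
    PureState (fun p : Fin c × ι => d p.2) :=
  Projectivization.mk ℂ (tensorPower c ψ.rep) (tensorPower_ne_zero c ψ.rep_nonzero)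

/-- The quotient topology of projective space. -/
instance (d : ι → ℕ) : TopologicalSpace (PureState d) :=
  inferInstanceAs (TopologicalSpace (Quotient (projectivizationSetoid ℂ (HilbertSpace d))))

/-- The Borel σ-algebra of projective space. -/
instance (d : ι → ℕ) : MeasurableSpace (PureState d) := borel _

instance (d : ι → ℕ) : BorelSpace (PureState d) := ⟨rfl⟩

/-- A unit vector representing a pure state (the phase is immaterial). -/
def PureState.unitVector [Fintype ι] [DecidableEq ι] {d : ι → ℕ} (ψ : PureState d) : HilbertSpace d :=
  ((‖ψ.rep‖⁻¹ : ℝ) : ℂ) • ψ.rep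

end States

/-! ### The uniform measure on pure states -/

section UniformMeasure

variable {ι : Type*} [Fintype ι] [DecidableEq ι]

instance unitaryGroup_compactSpace {X : Type*} [Fintype X] [DecidableEq X] :
    CompactSpace (unitaryGroup X ℂ) := by
  apply isCompact_iff_compactSpace.mp
  have hK : IsCompact (Set.pi Set.univ fun _ : X => Set.pi Set.univ fun _ : X =>
      Metric.closedBall (0 : ℂ) 1) :=
    isCompact_univ_pi fun _ => isCompact_univ_pi fun _ => isCompact_closedBall 0 1
  refine IsCompact.of_isClosed_subset hK (isClosed_unitary (R := Matrix X X ℂ)) ?_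
  intro U hU i _ j _
  simpa using entry_norm_bound_of_unitary hU i j

/-- The Borel σ-algebra of the unitary group. -/
instance unitaryGroup_measurableSpace {X : Type*} [Fintype X] [DecidableEq X] :
    MeasurableSpace (unitaryGroup X ℂ) := borel _

instance unitaryGroup_borelSpace {X : Type*} [Fintype X] [DecidableEq X] :
    BorelSpace (unitaryGroup X ℂ) := ⟨rfl⟩

theorem unitary_mulVec_injective {X : Type*} [Fintype X] [DecidableEq X]
    (U : unitaryGroup X ℂ) :
    Function.Injective (toEuclideanLin (U : Matrix X X ℂ)) := by
  intro v w h
  have h' : (U : Matrix X X ℂ) *ᵥ v.ofLp = (U : Matrix X X ℂ) *ᵥ w.ofLp :=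
    congrArg WithLp.ofLp h
  have hU : star (U : Matrix X X ℂ) * (U : Matrix X X ℂ) = 1 := U.2.1
  have := congrArg (fun z => star (U : Matrix X X ℂ) *ᵥ z) h'
  simp only [mulVec_mulVec, hU, one_mulVec] at this
  exact WithLp.ofLp_injective 2 this

/-- The action `ψ ↦ U ψ` of a unitary on pure states. -/
def unitaryAct {d : ι → ℕ} (U : unitaryGroup (∀ j, Fin (d j)) ℂ) : PureState d → PureState d :=
  Projectivization.map (toEuclideanLin (U : Matrix (∀ j, Fin (d j)) (∀ j, Fin (d j)) ℂ))
    (unitary_mulVec_injective U)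

/-- The product basis state `|0⟩ ⊗ |0⟩ ⊗ ⋯`, used as the reference point of the uniform measure. -/
def referenceState (d : ι → ℕ) [∀ j, NeZero (d j)] : PureState d :=
  Projectivization.mk ℂ (EuclideanSpace.single (0 : ∀ j, Fin (d j)) (1 : ℂ)) (by simp)

/-- The uniform probability measure on pure states: the law of `U ψ₀`, where `ψ₀` is a fixed state
and `U` is distributed according to the Haar probability measure of the unitary group. -/
def uniformMeasure (d : ι → ℕ) [∀ j, NeZero (d j)] : Measure (PureState d) :=
  Measure.map (fun U => unitaryAct U (referenceState d))
    (Measure.haarMeasure (⊤ : TopologicalSpace.PositiveCompacts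
      (unitaryGroup (∀ j, Fin (d j)) ℂ)))

theorem continuous_unitaryAct {d : ι → ℕ} (ψ : PureState d) :
    Continuous fun U => unitaryAct U ψ := by
  induction ψ using Projectivization.ind with
  | h v hv =>
    have h1 : Continuous fun U : unitaryGroup (∀ j, Fin (d j)) ℂ =>
        toEuclideanLin (U : Matrix (∀ j, Fin (d j)) (∀ j, Fin (d j)) ℂ) v := by
      change Continuous fun U : unitaryGroup (∀ j, Fin (d j)) ℂ =>
        WithLp.toLp 2 ((U : Matrix (∀ j, Fin (d j)) (∀ j, Fin (d j)) ℂ) *ᵥ v.ofLp)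
      exact (PiLp.continuous_toLp 2 _).comp
        (Continuous.matrix_mulVec continuous_subtype_val continuous_const)
    have h2 : Continuous fun U : unitaryGroup (∀ j, Fin (d j)) ℂ =>
        (⟨toEuclideanLin (U : Matrix (∀ j, Fin (d j)) (∀ j, Fin (d j)) ℂ) v,
          (map_ne_zero_iff _ (unitary_mulVec_injective U)).mpr hv⟩ :
          { w : HilbertSpace d // w ≠ 0 }) := h1.subtype_mk _
    exact (continuous_quotient_mk' (s := projectivizationSetoid ℂ (HilbertSpace d))).comp h2

instance (d : ι → ℕ) [∀ j, NeZero (d j)] : IsProbabilityMeasure (uniformMeasure d) := by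
  have : IsProbabilityMeasure (Measure.haarMeasure (⊤ : TopologicalSpace.PositiveCompacts
      (unitaryGroup (∀ j, Fin (d j)) ℂ))) :=
    ⟨by simpa using Measure.haarMeasure_self (K₀ := (⊤ : TopologicalSpace.PositiveCompacts
      (unitaryGroup (∀ j, Fin (d j)) ℂ)))⟩
  exact Measure.isProbabilityMeasure_map (continuous_unitaryAct _).measurable.aemeasurable

end UniformMeasure

/-! ### LOCC measurements and unambiguous discrimination -/

section LOCC

variable {ι : Type*}

/-- A finite LOCC protocol with final results in `α`, on parties whose subsystems currently have
the dimensions `d`. Either the protocol stops with a result, or every party `i` performs a local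
measurement with Kraus operators `K i 0, …, K i (r i - 1)` on its own subsystem (which turns it
into a system of dimension `e i a` at outcome `a`), all outcomes are broadcast, and the rest of the
protocol may depend on all of them. A party that stays idle in a round uses the single Kraus
operator `1`; a party that discards information does so by ignoring an outcome. -/
inductive LOCCProtocol (α : Type) : (ι → ℕ) → Type _
  | result {d : ι → ℕ} (a : α) : LOCCProtocol α d
  | round {d : ι → ℕ} (r : ι → ℕ) (e : ∀ i, Fin (r i) → ℕ)
      (K : ∀ (i : ι) (a : Fin (r i)), Matrix (Fin (e i a)) (Fin (d i)) ℂ)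
      (hK : ∀ i, ∑ a, (K i a)ᴴ * K i a = 1)
      (next : ∀ a : (∀ i, Fin (r i)), LOCCProtocol α fun i => e i (a i)) : LOCCProtocol α d

variable [Fintype ι]

/-- The tensor product `⨂ i, A i` of local operators, in the product bases. -/
def tensorOperator {d e : ι → ℕ} (A : ∀ i, Matrix (Fin (e i)) (Fin (d i)) ℂ) :
    Matrix (∀ i, Fin (e i)) (∀ i, Fin (d i)) ℂ :=
  Matrix.of fun x y => ∏ i, A i (x i) (y i)

variable [DecidableEq ι]

/-- The effect of the result `b`: the operator `E` such that the protocol, applied to a unit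
vector `u`, ends with the result `b` with probability `⟨u, E u⟩`. -/
def LOCCProtocol.effect {α : Type} [DecidableEq α] {d : ι → ℕ} :
    LOCCProtocol α d → α → Matrix (∀ i, Fin (d i)) (∀ i, Fin (d i)) ℂ
  | .result a, b => if a = b then 1 else 0
  | .round r _ K _ next, b => ∑ a : (∀ i, Fin (r i)),
      (tensorOperator fun i => K i (a i))ᴴ * (next a).effect b *
        tensorOperator fun i => K i (a i)

/-- A positive operator valued measure with outcomes in `α`. -/
def IsPOVM {α X : Type*} [Fintype α] [Fintype X] [DecidableEq X] (E : α → Matrix X X ℂ) : Prop :=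
  (∀ k, (E k).PosSemidef) ∧ ∑ k, E k = 1

/-- A POVM that can be implemented by local operations and classical communication. -/
def IsLOCCDecomposablePOVM {α : Type} [Fintype α] [DecidableEq α] {d : ι → ℕ}
    (E : α → Matrix (∀ i, Fin (d i)) (∀ i, Fin (d i)) ℂ) : Prop :=
  IsPOVM E ∧ ∃ P : LOCCProtocol α d, ∀ k, P.effect k = E k

/-- The probability `⟨ψ|E|ψ⟩` of the effect `E` in the pure state `ψ`. -/
def outcomeProbability {d : ι → ℕ} (E : Matrix (∀ i, Fin (d i)) (∀ i, Fin (d i)) ℂ)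
    (ψ : PureState d) : ℂ :=
  star ψ.unitVector.ofLp ⬝ᵥ E *ᵥ ψ.unitVector.ofLp

/-- The pure states `ψ 0, …, ψ (n - 1)` are unambiguously locally distinguishable: there is an
LOCC decomposable POVM `E 0, …, E n` such that `⟨ψ j|E (k + 1)|ψ j⟩ = 0` if and only if `j ≠ k`.
The outcome `0` is the inconclusive one. -/
def UnambiguouslyLocallyDistinguishable {d : ι → ℕ} {n : ℕ} (ψ : Fin n → PureState d) : Prop :=
  ∃ E : Fin (n + 1) → Matrix (∀ i, Fin (d i)) (∀ i, Fin (d i)) ℂ,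
    IsLOCCDecomposablePOVM E ∧
      ∀ j k : Fin n, outcomeProbability (E k.succ) (ψ j) = 0 ↔ j ≠ k

end LOCC

end Multipartite

end

noncomputable section

namespace Multipartite

/-! ### Product functionals and the criterion for unambiguous local discrimination -/

section ProductFunctional

variable {ι : Type*} [Fintype ι]

/-! Write `N = ∑ j, (d j - 1)`, the dimension of the Segre variety of product functionals up to
scalars. Unambiguous LOCC discrimination reduces to linear algebra: each state `k` needs a product
functional that vanishes on exactly the other states. Necessity holds because every branch of a
protocol acts by a tensor product of local operators; sufficiency is a one-round protocol of local
projections (`exists_productFunctional_of_unambiguouslyLocallyDistinguishable`,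
`unambiguouslyLocallyDistinguishable_of_productFunctional`).

On `c` copies a product functional is a `c`-tuple of product functionals of one copy, and its value
at `ψ^{⊗c}` is the product of theirs. So the `n - 1` other states must be covered by `c` sets, each
annihilated by a product functional that is non-zero at state `k`. Any `N` vectors have a common
non-zero product annihilator, by Krull's height theorem on the Segre cone
(`exists_productFunctional_eq_zero`), while generically no `N + 1` do, by a parameter count
(`addHaar_degenerateTuples`). Hence generically each of the `c` sets has at most `N` members, and
this is attained: the bound is `n - 1 ≤ c * N`.

The exceptional set is closed, Lebesgue null and invariant under rescaling; Fubini and Haar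
invariance make it null for the uniform measure (`ae_uniformMeasure_rep_notMem`). -/

theorem tensorOperator_one {d : ι → ℕ} :
    tensorOperator (fun i => (1 : Matrix (Fin (d i)) (Fin (d i)) ℂ)) = 1 := by
  ext x y
  by_cases h : x = y
  · subst h; simp [tensorOperator]
  · obtain ⟨i, hi⟩ := Function.ne_iff.mp h
    rw [one_apply_ne h, tensorOperator, of_apply]
    exact Finset.prod_eq_zero (Finset.mem_univ i) (one_apply_ne hi)

variable [DecidableEq ι]

/-- The value at `v` of the linear functional `⨂ i, φ i` on `⨂ i, ℂ^(d i)`. -/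
def productFunctional {d : ι → ℕ} (φ : ∀ i, Fin (d i) → ℂ) (v : (∀ i, Fin (d i)) → ℂ) : ℂ :=
  (fun y => ∏ i, φ i (y i)) ⬝ᵥ v

theorem productFunctional_smul {d : ι → ℕ} (φ : ∀ i, Fin (d i) → ℂ) (a : ℂ)
    (v : (∀ i, Fin (d i)) → ℂ) : productFunctional φ (a • v) = a * productFunctional φ v := by
  simp [productFunctional, dotProduct_smul]

theorem ne_zero_of_productFunctional_ne_zero {d : ι → ℕ} {φ : ∀ i, Fin (d i) → ℂ}
    {v : (∀ i, Fin (d i)) → ℂ} (h : productFunctional φ v ≠ 0) (i : ι) : φ i ≠ 0 := by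
  intro hi
  apply h
  simp only [productFunctional, dotProduct]
  refine Finset.sum_eq_zero fun y _ => ?_
  rw [Finset.prod_eq_zero (Finset.mem_univ i) (by simp [hi]), zero_mul]

theorem productFunctional_tensorOperator {d e : ι → ℕ} (φ : ∀ i, Fin (e i) → ℂ)
    (A : ∀ i, Matrix (Fin (e i)) (Fin (d i)) ℂ) (v : (∀ i, Fin (d i)) → ℂ) :
    productFunctional φ (tensorOperator A *ᵥ v) = productFunctional (fun i => φ i ᵥ* A i) v := by
  rw [productFunctional, dotProduct_mulVec, productFunctional]
  congr 1
  ext y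
  simp only [vecMul, dotProduct, tensorOperator, of_apply, Finset.prod_univ_sum,
    ← Finset.prod_mul_distrib, Fintype.piFinset_univ]

theorem tensorOperator_conjTranspose_mul_self {d e : ι → ℕ}
    (A : ∀ i, Matrix (Fin (e i)) (Fin (d i)) ℂ) :
    (tensorOperator A)ᴴ * tensorOperator A = tensorOperator fun i => (A i)ᴴ * A i := by
  ext x y
  simp only [mul_apply, tensorOperator, of_apply, conjTranspose_apply, Finset.prod_univ_sum,
    Fintype.piFinset_univ, Finset.prod_mul_distrib, star_prod]

theorem sum_tensorOperator {d e r : ι → ℕ}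
    (B : ∀ i, Fin (r i) → Matrix (Fin (e i)) (Fin (d i)) ℂ) :
    ∑ a : (∀ i, Fin (r i)), tensorOperator (fun i => B i (a i)) =
      tensorOperator fun i => ∑ a, B i a := by
  ext x y
  simp only [Matrix.sum_apply, tensorOperator, of_apply, Finset.prod_univ_sum,
    Fintype.piFinset_univ]

variable {α : Type} [DecidableEq α]

theorem LOCCProtocol.effect_posSemidef {d : ι → ℕ} (P : LOCCProtocol α d) (b : α) :
    (P.effect b).PosSemidef := by
  induction P with
  | result a =>
    rw [effect]
    split
    exacts [PosSemidef.one, PosSemidef.zero]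
  | round r e K hK next ih =>
    rw [effect]
    exact posSemidef_sum _ fun a _ => (ih a).conjTranspose_mul_mul_same _

theorem LOCCProtocol.sum_effect [Fintype α] {d : ι → ℕ} (P : LOCCProtocol α d) :
    ∑ b, P.effect b = 1 := by
  induction P with
  | result a => simp [effect]
  | round r e K hK next ih =>
    simp only [effect]
    rw [Finset.sum_comm]
    simp only [← Matrix.sum_mul, ← Matrix.mul_sum, ih, Matrix.mul_one,
      tensorOperator_conjTranspose_mul_self]
    rw [sum_tensorOperator fun i a => (K i a)ᴴ * K i a]
    simp only [hK, tensorOperator_one]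

theorem LOCCProtocol.isLOCCDecomposablePOVM [Fintype α] {d : ι → ℕ} (P : LOCCProtocol α d) :
    IsLOCCDecomposablePOVM P.effect :=
  ⟨⟨P.effect_posSemidef, P.sum_effect⟩, P, fun _ => rfl⟩

theorem dotProduct_conjTranspose_mul_mul_mulVec {X Z : Type*} [Fintype X] [Fintype Z]
    (T : Matrix Z X ℂ) (E : Matrix Z Z ℂ) (u : X → ℂ) :
    star u ⬝ᵥ (Tᴴ * E * T) *ᵥ u = star (T *ᵥ u) ⬝ᵥ E *ᵥ (T *ᵥ u) := by
  rw [star_mulVec, ← dotProduct_mulVec, mulVec_mulVec, mulVec_mulVec, Matrix.mul_assoc]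

/-- An effect of a protocol which is non-zero on `u` yields a product functional which does not
vanish at `u`, but vanishes wherever the effect does. -/
theorem LOCCProtocol.exists_productFunctional {d : ι → ℕ} (P : LOCCProtocol α d) (b : α)
    (u : (∀ i, Fin (d i)) → ℂ) (hu : star u ⬝ᵥ P.effect b *ᵥ u ≠ 0) :
    ∃ φ : ∀ i, Fin (d i) → ℂ, productFunctional φ u ≠ 0 ∧
      ∀ w, star w ⬝ᵥ P.effect b *ᵥ w = 0 → productFunctional φ w = 0 := by
  induction P with
  | result a =>
    rw [effect] at hu ⊢
    split at hu
    · rw [if_pos ‹_›]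
      rw [one_mulVec, Ne, dotProduct_star_self_eq_zero] at hu
      obtain ⟨x, hx⟩ := Function.ne_iff.mp hu
      -- Here the effect is the identity, and taking the coordinate at `x` is itself a product
      -- functional.
      have key : ∀ v : (∀ i, Fin (_)) → ℂ,
          productFunctional (fun i => Pi.single (x i) 1) v = v x := fun v => by
        rw [productFunctional, dotProduct, Finset.sum_eq_single x]
        · simp
        · intro y _ hy
          obtain ⟨i, hi⟩ := Function.ne_iff.mp hy
          rw [Finset.prod_eq_zero (Finset.mem_univ i) (Pi.single_eq_of_ne hi _), zero_mul]
        · simp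
      refine ⟨_, (key u).trans_ne hx, fun w hw => ?_⟩
      rw [one_mulVec, dotProduct_star_self_eq_zero] at hw
      rw [key, hw, Pi.zero_apply]
    · simp at hu
  | round r e K hK next ih =>
    simp only [effect, sum_mulVec, dotProduct_sum,
      dotProduct_conjTranspose_mul_mul_mulVec] at hu ⊢
    -- Follow one branch that `u` reaches. Since all branches contribute non-negatively, a vanishing
    -- total forces this branch to vanish at `w` too.
    obtain ⟨a, -, ha⟩ := Finset.exists_ne_zero_of_sum_ne_zero hu
    obtain ⟨φ, hφ, h⟩ := ih a _ ha
    refine ⟨_, (productFunctional_tensorOperator φ _ u) ▸ hφ, fun w hw => ?_⟩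
    rw [← productFunctional_tensorOperator]
    refine h _ ?_
    rw [Finset.sum_eq_zero_iff_of_nonneg] at hw
    · exact hw a (Finset.mem_univ a)
    · exact fun a _ => ((next a).effect_posSemidef b).dotProduct_mulVec_nonneg _

/-- The orthogonal projection onto the line of the conjugate of `φ`. -/
def functionalProjection {X : Type*} [Fintype X] (φ : X → ℂ) : Matrix X X ℂ :=
  (star φ ⬝ᵥ φ)⁻¹ • vecMulVec (star φ) φ

theorem functionalProjection_conjTranspose {X : Type*} [Fintype X] (φ : X → ℂ) :
    (functionalProjection φ)ᴴ = functionalProjection φ := by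
  have h : star (star φ ⬝ᵥ φ) = star φ ⬝ᵥ φ := by rw [← star_dotProduct]
  rw [functionalProjection, conjTranspose_smul, conjTranspose_vecMulVec, star_star, star_inv₀, h]

theorem functionalProjection_mul_self {X : Type*} [Fintype X] {φ : X → ℂ} (hφ : φ ≠ 0) :
    functionalProjection φ * functionalProjection φ = functionalProjection φ := by
  have h : star φ ⬝ᵥ φ ≠ 0 := by simpa using hφ
  rw [functionalProjection, smul_mul_smul_comm, vecMulVec_mul_vecMulVec, dotProduct_comm φ,
    vecMulVec_smul, smul_smul]
  congr 1
  field_simp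

theorem tensorOperator_functionalProjection_mulVec {d : ι → ℕ} (s : ℂ)
    (φ : ∀ i, Fin (d i) → ℂ) (u : (∀ i, Fin (d i)) → ℂ) :
    tensorOperator (fun i => s • functionalProjection (φ i)) *ᵥ u =
      ((∏ i, s * (star (φ i) ⬝ᵥ φ i)⁻¹) * productFunctional φ u) •
        fun x => ∏ i, star (φ i (x i)) := by
  ext x
  simp only [mulVec, dotProduct, tensorOperator, functionalProjection, of_apply, Matrix.smul_apply,
    smul_eq_mul, vecMulVec_apply, Pi.smul_apply, productFunctional, Finset.prod_mul_distrib,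
    Finset.mul_sum, Finset.sum_mul, Pi.star_apply]
  exact Finset.sum_congr rfl fun y _ => by ring

theorem tensorOperator_functionalProjection_mulVec_eq_zero_iff {d : ι → ℕ} {s : ℂ} (hs : s ≠ 0)
    {φ : ∀ i, Fin (d i) → ℂ} (hφ : ∀ i, φ i ≠ 0) (u : (∀ i, Fin (d i)) → ℂ) :
    tensorOperator (fun i => s • functionalProjection (φ i)) *ᵥ u = 0 ↔
      productFunctional φ u = 0 := by
  rw [tensorOperator_functionalProjection_mulVec, smul_eq_zero, mul_eq_zero, Finset.prod_eq_zero_iff]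
  constructor
  · rintro ((⟨i, -, hi⟩ | h) | h)
    · simp [hs, hφ i] at hi
    · exact h
    · choose x hx using fun i => Function.ne_iff.mp (hφ i)
      have := congrFun h x
      simp only [Pi.zero_apply, Finset.prod_eq_zero_iff, star_eq_zero] at this
      obtain ⟨i, -, hi⟩ := this
      exact absurd hi (hx i)
  · exact fun h => Or.inl (Or.inr h)

end ProductFunctional

/-! ### Unambiguous LOCC discrimination and product functionals -/

section Criterion

variable {ι : Type*} [Fintype ι] [DecidableEq ι] {d : ι → ℕ}

theorem outcomeProbability_mk_eq_zero_iff (E : Matrix (∀ i, Fin (d i)) (∀ i, Fin (d i)) ℂ)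
    (v : HilbertSpace d) (hv : v ≠ 0) :
    outcomeProbability E (Projectivization.mk ℂ v hv) = 0 ↔
      star v.ofLp ⬝ᵥ E *ᵥ v.ofLp = 0 := by
  obtain ⟨a, ha⟩ := Projectivization.exists_smul_eq_mk_rep ℂ v hv
  have hn : (((‖(Projectivization.mk ℂ v hv).rep‖⁻¹ : ℝ) : ℂ)) ≠ 0 := by
    simpa using (Projectivization.mk ℂ v hv).rep_nonzero
  rw [outcomeProbability, PureState.unitVector, WithLp.ofLp_smul, star_smul, mulVec_smul,
    smul_dotProduct, dotProduct_smul, smul_eq_zero_iff_right (star_ne_zero.mpr hn),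
    smul_eq_zero_iff_right hn, ← ha, Units.smul_def, WithLp.ofLp_smul, star_smul, mulVec_smul,
    smul_dotProduct, dotProduct_smul, smul_eq_zero_iff_right (star_ne_zero.mpr a.ne_zero),
    smul_eq_zero_iff_right a.ne_zero]

theorem exists_productFunctional_of_unambiguouslyLocallyDistinguishable {n : ℕ}
    (v : Fin n → HilbertSpace d) (hv : ∀ k, v k ≠ 0)
    (h : UnambiguouslyLocallyDistinguishable fun k => Projectivization.mk ℂ (v k) (hv k))
    (k : Fin n) :
    ∃ φ : ∀ i, Fin (d i) → ℂ, ∀ l, productFunctional φ (v l).ofLp = 0 ↔ l ≠ k := by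
  obtain ⟨E, ⟨-, P, hP⟩, hE⟩ := h
  simp only [outcomeProbability_mk_eq_zero_iff, ← hP] at hE
  obtain ⟨φ, h1, h2⟩ := P.exists_productFunctional k.succ (v k).ofLp
    (fun h => (hE k k).mp h rfl)
  exact ⟨φ, fun l => ⟨fun h hl => h1 (hl ▸ h), fun hl => h2 _ ((hE l k).mpr hl)⟩⟩

/-- The protocol that always announces `Fin.last n` works. This also covers a system without
parties, which the general construction excludes. -/
theorem unambiguouslyLocallyDistinguishable_of_le_one {n : ℕ} (hn : n ≤ 1)
    (ψ : Fin n → PureState d) : UnambiguouslyLocallyDistinguishable ψ := by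
  refine ⟨_, (LOCCProtocol.result (Fin.last n)).isLOCCDecomposablePOVM, fun j k => ?_⟩
  have hjk : j = k := Fin.ext (by omega)
  have hk : Fin.last n = k.succ := Fin.ext (by simp; omega)
  have := outcomeProbability_mk_eq_zero_iff
    ((LOCCProtocol.result (Fin.last n) : LOCCProtocol _ d).effect k.succ) (ψ j).rep
    (ψ j).rep_nonzero
  rw [Projectivization.mk_rep] at this
  rw [this, LOCCProtocol.effect, if_pos hk, one_mulVec, dotProduct_star_self_eq_zero]
  simpa [hjk] using (ψ k).rep_nonzero

/-- Every party guesses a label `k` uniformly and independently, then tests its subsystem with the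
projection attached to `φ k i`. The answer `k` is given only if all parties guessed `k` and all
tests succeeded, an event whose amplitude is a non-zero multiple of the value of `φ k`. -/
theorem unambiguouslyLocallyDistinguishable_of_productFunctional [Nonempty ι] {n : ℕ}
    (v : Fin n → HilbertSpace d) (hv : ∀ k, v k ≠ 0)
    (h : ∀ k, ∃ φ : ∀ i, Fin (d i) → ℂ, ∀ l, productFunctional φ (v l).ofLp = 0 ↔ l ≠ k) :
    UnambiguouslyLocallyDistinguishable fun k => Projectivization.mk ℂ (v k) (hv k) := by
  rcases Nat.eq_zero_or_pos n with rfl | hn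
  · exact unambiguouslyLocallyDistinguishable_of_le_one (by simp) _
  choose φ hφ using h
  have hφ0 : ∀ k i, φ k i ≠ 0 := fun k i =>
    ne_zero_of_productFunctional_ne_zero (v := (v k).ofLp) (fun h => (hφ k k).mp h rfl) i
  -- Amplitude of a uniform guess among `n` labels.
  let s : ℂ := ((√(n : ℝ))⁻¹ : ℝ)
  have hs : star s * s = (n : ℂ)⁻¹ := by
    simp only [s, RCLike.star_def, Complex.conj_ofReal]
    rw [← Complex.ofReal_mul, ← mul_inv, Real.mul_self_sqrt n.cast_nonneg]
    simp
  have hn0 : (n : ℂ) ≠ 0 := by exact_mod_cast hn.ne'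
  have hs0 : s ≠ 0 := by
    rintro h0
    rw [h0, mul_zero] at hs
    exact inv_ne_zero hn0 hs.symm
  let code : Fin (Fintype.card (Fin n × Bool)) ≃ Fin n × Bool := (Fintype.equivFin _).symm
  let kraus : ∀ i : ι, Fin n × Bool → Matrix (Fin (d i)) (Fin (d i)) ℂ := fun i p =>
    s • if p.2 then functionalProjection (φ p.1 i) else 1 - functionalProjection (φ p.1 i)
  have hkraus : ∀ i, ∑ a, (kraus i (code a))ᴴ * kraus i (code a) = 1 := by
    intro i
    rw [code.sum_comp fun p => (kraus i p)ᴴ * kraus i p, Fintype.sum_prod_type]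
    have : ∀ k : Fin n, ∑ b : Bool, (kraus i (k, b))ᴴ * kraus i (k, b) = (n : ℂ)⁻¹ • 1 := by
      intro k
      rw [Fintype.sum_bool]
      simp only [kraus, if_true, Bool.false_eq_true, if_false, conjTranspose_smul,
        smul_mul_smul_comm, hs, conjTranspose_sub, functionalProjection_conjTranspose,
        conjTranspose_one, ← smul_add]
      simp only [Matrix.mul_sub, Matrix.sub_mul, functionalProjection_mul_self (hφ0 k i),
        Matrix.mul_one, Matrix.one_mul, sub_self, sub_zero, add_sub_cancel]
    simp only [this, Finset.sum_const, Finset.card_univ, Fintype.card_fin]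
    rw [← Nat.cast_smul_eq_nsmul ℂ, smul_smul, mul_inv_cancel₀ hn0, one_smul]
  let res : (ι → Fin (Fintype.card (Fin n × Bool))) → Fin (n + 1) := fun a =>
    if h : ∃ k, ∀ i, code (a i) = (k, true) then h.choose.succ else 0
  have hres : ∀ a k, res a = k.succ ↔ a = fun _ => code.symm (k, true) := by
    intro a k
    constructor
    · intro h
      by_cases h' : ∃ k, ∀ i, code (a i) = (k, true)
      · simp only [res, dif_pos h', Fin.succ_inj] at h
        ext1 i
        rw [Equiv.eq_symm_apply, h'.choose_spec i, h]
      · simp only [res, dif_neg h'] at h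
        exact absurd h (Fin.succ_ne_zero k).symm
    · rintro rfl
      have h' : ∃ k', ∀ _ : ι, code (code.symm (k, true)) = (k', true) := ⟨k, by simp⟩
      -- A party is needed to read off the label: with none, every `k` would qualify.
      have h2 := h'.choose_spec (Classical.arbitrary ι)
      simp only [res, dif_pos h', Fin.succ_inj]
      exact (Prod.mk.inj (h2.symm.trans (code.apply_symm_apply _))).1
  let P : LOCCProtocol (Fin (n + 1)) d :=
    .round (fun _ => Fintype.card (Fin n × Bool)) (fun i _ => d i) (fun i a => kraus i (code a))
      hkraus fun a => .result (res a)
  refine ⟨_, P.isLOCCDecomposablePOVM, fun j k => ?_⟩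
  rw [outcomeProbability_mk_eq_zero_iff, ← hφ k j]
  simp only [P, LOCCProtocol.effect, sum_mulVec, dotProduct_sum,
    dotProduct_conjTranspose_mul_mul_mulVec]
  rw [Finset.sum_eq_single fun _ => code.symm (k, true)]
  · rw [if_pos ((hres _ k).mpr rfl), one_mulVec, dotProduct_star_self_eq_zero]
    simp only [Equiv.apply_symm_apply, kraus, if_true]
    exact tensorOperator_functionalProjection_mulVec_eq_zero_iff hs0 (hφ0 k) _
  · intro a _ ha
    rw [if_neg (fun h => ha ((hres a k).mp h)), zero_mulVec, dotProduct_zero]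
  · simp

end Criterion

/-! ### The Segre cone and the existence of orthogonal product vectors -/

section Segre

open MvPolynomial

variable {ι : Type*} [Fintype ι] (d : ι → ℕ) [∀ j, NeZero (d j)]

theorem card_segreCoord_factor :
    Fintype.card (Σ j, {a : Fin (d j) // a ≠ 0}) = ∑ j, (d j - 1) := by
  simp [Fintype.card_subtype_compl]

/-- Affine coordinates of the Segre cone: the non-zeroth coordinates of the factors, and a common
scaling factor. -/
abbrev SegreCoord : Type _ := Option (Σ j, {a : Fin (d j) // a ≠ 0})

variable {d} in
/-- The coordinates of a factor, the zeroth one being `1`. -/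
def segreEntry (j : ι) (a : Fin (d j)) : MvPolynomial (SegreCoord d) ℂ :=
  if h : a = 0 then 1 else X (some ⟨j, a, h⟩)

/-- The parametrization of the Segre cone, as a homomorphism of coordinate rings. -/
def segreHom : MvPolynomial (∀ j, Fin (d j)) ℂ →ₐ[ℂ] MvPolynomial (SegreCoord d) ℂ :=
  aeval fun y => X none * ∏ j, segreEntry j (y j)

/-- An enumeration of the coordinates of the Segre cone; the scaling factor is the last one. -/
def segreRank : SegreCoord d → ℕ
  | none => ∑ j, (d j - 1)
  | some p => Fintype.equivFinOfCardEq (card_segreCoord_factor d) p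

theorem segreRank_lt_succ (s : SegreCoord d) : segreRank d s < ∑ j, (d j - 1) + 1 := by
  cases s with
  | none => simp [segreRank]
  | some p => simp only [segreRank]; omega

theorem exists_segreRank_eq {k : ℕ} (hk : k < ∑ j, (d j - 1) + 1) :
    ∃ s, segreRank d s = k := by
  rcases Nat.lt_succ_iff_lt_or_eq.mp hk with h | h
  · exact ⟨some ((Fintype.equivFinOfCardEq (card_segreCoord_factor d)).symm ⟨k, h⟩), by
      simp [segreRank]⟩
  · exact ⟨none, h.symm⟩

/-- Setting the first `k` coordinates to zero. -/
def segreKill (k : ℕ) : MvPolynomial (SegreCoord d) ℂ →ₐ[ℂ] MvPolynomial (SegreCoord d) ℂ :=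
  aeval fun s => if segreRank d s < k then 0 else X s

theorem segreKill_comp {k l : ℕ} (h : k ≤ l) :
    (segreKill d l).comp (segreKill d k) = segreKill d l := by
  ext1 s
  simp only [segreKill, AlgHom.comp_apply, aeval_X]
  by_cases h1 : segreRank d s < k
  · simp [h1, h1.trans_le h]
  · simp [h1]

/-- The prime ideal of the part of the Segre cone where the first `k` coordinates vanish. -/
def segrePrime (k : ℕ) : Ideal (segreHom d).range :=
  RingHom.ker ((segreKill d k).comp (segreHom d).range.val)

instance (k : ℕ) : (segrePrime d k).IsPrime := RingHom.ker_isPrime _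

theorem mem_segrePrime {k : ℕ} {a : (segreHom d).range} :
    a ∈ segrePrime d k ↔ segreKill d k a = 0 := Iff.rfl

/-- Every generator maps to a multiple of the scaling coordinate, so only the constant term
survives. Thus the last prime of the chain is the ideal of the vertex of the cone. -/
theorem segreKill_segreHom (q : MvPolynomial (∀ j, Fin (d j)) ℂ) :
    segreKill d (∑ j, (d j - 1) + 1) (segreHom d q) = C (aeval 0 q) := by
  have : (segreKill d (∑ j, (d j - 1) + 1)).comp (segreHom d) =
      (Algebra.ofId ℂ _).comp (aeval (0 : (∀ j, Fin (d j)) → ℂ)) := by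
    ext1 y
    simp only [AlgHom.comp_apply, segreHom, aeval_X, map_mul, segreKill,
      if_pos (segreRank_lt_succ d none), zero_mul]
    simp
  exact DFunLike.congr_fun this q

variable [DecidableEq ι]

/-- The witness is the monomial of a basis tuple differing from `0` in at most one place: it equals
the scaling coordinate, times the `k`-th coordinate if that one belongs to a factor. It is not
killed too early because the scaling coordinate has the last rank. -/
theorem segrePrime_lt_succ {k : ℕ} (hk : k < ∑ j, (d j - 1) + 1) :
    segrePrime d k < segrePrime d (k + 1) := by
  refine lt_of_le_of_ne (fun a ha => ?_) fun h => ?_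
  · rw [mem_segrePrime] at ha ⊢
    rw [← segreKill_comp d k.le_succ, AlgHom.comp_apply, ha, map_zero]
  · obtain ⟨s, hs⟩ := exists_segreRank_eq d hk
    have hnone : segreKill d k (X none) = X none := by
      have : ¬ segreRank d none < k := by simp only [segreRank]; omega
      simp [segreKill, this]
    have hsk : segreKill d k (X s) = X s := by simp [segreKill, hs]
    have hsk' : segreKill d (k + 1) (X s) = 0 := by simp [segreKill, hs]
    obtain ⟨y, h0, h1⟩ : ∃ y, segreKill d k (segreHom d (X y)) ≠ 0 ∧
        segreKill d (k + 1) (segreHom d (X y)) = 0 := by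
      cases s with
      | none =>
        refine ⟨0, ?_⟩
        have : segreHom d (X 0) = X none := by simp [segreHom, segreEntry]
        rw [this, hnone]
        exact ⟨X_ne_zero _, hsk'⟩
      | some p =>
        obtain ⟨j, a, ha⟩ := p
        refine ⟨Function.update 0 j a, ?_⟩
        have : segreHom d (X (Function.update 0 j a)) = X none * X (some ⟨j, a, ha⟩) := by
          rw [segreHom, aeval_X, Finset.prod_eq_single j]
          · simp [segreEntry, ha]
          · intro i _ hi
            simp [segreEntry, Function.update_of_ne hi]
          · simp
        rw [this, map_mul, map_mul, hnone, hsk, hsk', mul_zero]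
        exact ⟨mul_ne_zero (X_ne_zero _) (X_ne_zero _), rfl⟩
    have hmem : (⟨segreHom d (X y), AlgHom.mem_range_self _ _⟩ : (segreHom d).range) ∈
        segrePrime d (k + 1) := h1
    rw [← h] at hmem
    exact h0 hmem

theorem le_height_segrePrime {k : ℕ} (hk : k ≤ ∑ j, (d j - 1) + 1) :
    (k : ℕ∞) ≤ (segrePrime d k).height := by
  induction k with
  | zero => simp
  | succ k ih =>
    push_cast
    exact (add_le_add_left (ih (by omega)) 1).trans
      (Ideal.height_add_one_le_of_lt_of_isPrime (segrePrime_lt_succ d (by omega)))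

/-- These relations suffice to recognise the cone: a point with `z x ≠ 0` is a multiple of the
product of its slices through `x`. The extra factor `X x` avoids the exponent `Fintype.card ι - 1`.
-/
theorem segre_relation_mem_ker (x y : ∀ j, Fin (d j)) :
    X y * X x ^ Fintype.card ι - X x * ∏ j, X (Function.update x j (y j)) ∈
      RingHom.ker (segreHom d) := by
  rw [RingHom.mem_ker, map_sub, sub_eq_zero]
  simp only [map_mul, map_pow, map_prod, segreHom, aeval_X]
  have h : ∀ j, ∏ i, segreEntry i (Function.update x j (y j) i) =
      segreEntry j (y j) * ∏ i ∈ Finset.univ.erase j, segreEntry i (x i) := by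
    intro j
    rw [← Finset.mul_prod_erase _ _ (Finset.mem_univ j), Function.update_self]
    congr 1
    refine Finset.prod_congr rfl fun i hi => ?_
    rw [Function.update_of_ne (Finset.ne_of_mem_erase hi)]
  have h2 : (∏ i, segreEntry i (x i)) ^ Fintype.card ι =
      (∏ i, segreEntry i (x i)) * ∏ j, ∏ i ∈ Finset.univ.erase j, segreEntry i (x i) := by
    rw [← Finset.prod_mul_distrib]
    rw [Finset.prod_congr rfl fun j _ =>
      Finset.mul_prod_erase Finset.univ (fun i => segreEntry i (x i)) (Finset.mem_univ j),
      Finset.prod_const, Finset.card_univ]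
  simp only [h, mul_pow, h2, Finset.prod_mul_distrib, Finset.prod_const, Finset.card_univ]
  ring

variable {d} in
/-- Any `∑ j, (d j - 1)` vectors are annihilated by a non-zero product functional. -/
theorem exists_productFunctional_eq_zero (v : Fin (∑ j, (d j - 1)) → (∀ j, Fin (d j)) → ℂ) :
    ∃ φ : ∀ j, Fin (d j) → ℂ, (∀ j, φ j ≠ 0) ∧ ∀ l, productFunctional φ (v l) = 0 := by
  classical
  by_contra! hno
  let f : Fin (∑ j, (d j - 1)) → MvPolynomial (∀ j, Fin (d j)) ℂ := fun l => ∑ y, C (v l y) * X y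
  let J : Ideal (MvPolynomial (∀ j, Fin (d j)) ℂ) :=
    RingHom.ker (segreHom d) ⊔ Ideal.span (Set.range f)
  -- If no product functional annihilates all `v l`, the hyperplanes meet the cone only in its
  -- vertex.
  have hJ : ∀ z ∈ zeroLocus ℂ J, z = 0 := by
    intro z hz
    by_contra hz0
    obtain ⟨x, hx⟩ := Function.ne_iff.mp hz0
    rw [Pi.zero_apply] at hx
    obtain ⟨l, hl⟩ := hno (fun j a => z (Function.update x j a)) fun j h =>
      hx (by simpa using congrFun h (x j))
    have hrel : ∀ y, z x * ∏ j, z (Function.update x j (y j)) = z y * z x ^ Fintype.card ι := by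
      intro y
      have := hz _ (Ideal.mem_sup_left (segre_relation_mem_ker d x y))
      simp only [map_sub, map_mul, map_pow, map_prod, aeval_X] at this
      exact (sub_eq_zero.mp this).symm
    have hf : ∑ y, v l y * z y = 0 := by
      have := hz (f l) (Ideal.mem_sup_right (Ideal.subset_span ⟨l, rfl⟩))
      simpa [f] using this
    refine mul_ne_zero hx hl ?_
    rw [productFunctional, dotProduct, Finset.mul_sum]
    simp only [← mul_assoc, hrel]
    calc ∑ y, z y * z x ^ Fintype.card ι * v l y
        = z x ^ Fintype.card ι * ∑ y, v l y * z y := by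
          rw [Finset.mul_sum]; exact Finset.sum_congr rfl fun y _ => by ring
      _ = 0 := by rw [hf, mul_zero]
  have hrad : ∀ q : MvPolynomial (∀ j, Fin (d j)) ℂ,
      aeval (0 : (∀ j, Fin (d j)) → ℂ) q = 0 → q ∈ J.radical := by
    intro q hq
    rw [← vanishingIdeal_zeroLocus_eq_radical (K := ℂ)]
    intro z hz
    rw [hJ z hz, hq]
  let g : Fin (∑ j, (d j - 1)) → (segreHom d).range := fun l => (segreHom d).rangeRestrict (f l)
  -- By the Nullstellensatz the vertex ideal is then minimal over `N` generators, so its height is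
  -- at most `N`; the chain of primes gives at least `N + 1`.
  have hmin : segrePrime d (∑ j, (d j - 1) + 1) ∈
      (Ideal.span ((Finset.univ.image g : Finset _) : Set (segreHom d).range)).minimalPrimes := by
    refine ⟨⟨inferInstance, ?_⟩, ?_⟩
    · rw [Ideal.span_le]
      intro a ha
      obtain ⟨l, -, rfl⟩ := Finset.mem_image.mp (Finset.mem_coe.mp ha)
      change segreKill d _ (segreHom d (f l)) = 0
      rw [segreKill_segreHom]
      simp [f]
    · rintro Q ⟨hQ, hIQ⟩ - a ha
      obtain ⟨q, rfl⟩ := (segreHom d).rangeRestrict_surjective a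
      have hJQ : J ≤ Q.comap (segreHom d).rangeRestrict := by
        refine sup_le (fun p hp => ?_) (Ideal.span_le.mpr ?_)
        · rw [Ideal.mem_comap]
          have : (segreHom d).rangeRestrict p = 0 := Subtype.ext hp
          rw [this]
          exact Q.zero_mem
        · rintro _ ⟨l, rfl⟩
          exact hIQ (Ideal.subset_span (by simp [g]))
      have hq : aeval (0 : (∀ j, Fin (d j)) → ℂ) q = 0 := by
        have : segreKill d _ (segreHom d q) = 0 := ha
        rwa [segreKill_segreHom, C_eq_zero] at this
      exact (hQ.comap (segreHom d).rangeRestrict).radical_le_iff.mpr hJQ (hrad q hq)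
  have hfin : IsNoetherianRing (segreHom d).range :=
    isNoetherianRing_of_surjective _ _ (segreHom d).rangeRestrict.toRingHom
      (segreHom d).rangeRestrict_surjective
  have h1 := Ideal.height_le_card_of_mem_minimalPrimes_span_finset hmin
  have h2 := (le_height_segrePrime d le_rfl).trans h1
  have h3 : (Finset.univ.image g).card ≤ ∑ j, (d j - 1) := by
    simpa using Finset.card_image_le (s := Finset.univ) (f := g)
  have := (Nat.cast_le (α := ℕ∞)).mp h2
  omega

end Segre

/-! ### Tuples of vectors with too many common orthogonal product vectors -/

section Degenerate

variable {ι : Type*} [Fintype ι] [DecidableEq ι]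

theorem productFunctional_smul_left {d : ι → ℕ} (a : ι → ℂ) (φ : ∀ i, Fin (d i) → ℂ)
    (v : (∀ i, Fin (d i)) → ℂ) :
    productFunctional (fun i => a i • φ i) v = (∏ i, a i) * productFunctional φ v := by
  simp only [productFunctional, dotProduct, Pi.smul_apply, smul_eq_mul, Finset.prod_mul_distrib,
    Finset.mul_sum, mul_assoc]

variable {κ : Type*}

/-- The tuples of vectors containing `∑ j, (d j - 1) + 1` members which are annihilated by a
common non-zero product functional. -/
def degenerateTuples (κ : Type*) (d : ι → ℕ) : Set (κ → (∀ j, Fin (d j)) → ℂ) :=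
  {v | ∃ S : Finset κ, S.card = ∑ j, (d j - 1) + 1 ∧
    ∃ φ : ∀ j, Fin (d j) → ℂ, (∀ j, φ j ≠ 0) ∧ ∀ l ∈ S, productFunctional φ (v l) = 0}

theorem smul_mem_degenerateTuples {d : ι → ℕ} {v : κ → (∀ j, Fin (d j)) → ℂ}
    (hv : v ∈ degenerateTuples κ d) (r : κ → ℂ) : (fun l => r l • v l) ∈ degenerateTuples κ d := by
  obtain ⟨S, hS, φ, hφ, h⟩ := hv
  exact ⟨S, hS, φ, hφ, fun l hl => by rw [productFunctional_smul, h l hl, mul_zero]⟩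

variable [Fintype κ]

/-- After normalization the functionals range over a product of unit spheres, and projection along a
compact factor is closed. -/
theorem isClosed_degenerateTuples (d : ι → ℕ) : IsClosed (degenerateTuples κ d) := by
  let T (S : Finset κ) : Set ((∀ j, Metric.sphere (0 : Fin (d j) → ℂ) 1) ×
      (κ → (∀ j, Fin (d j)) → ℂ)) :=
    {p | ∀ l ∈ S, productFunctional (fun j => (p.1 j : Fin (d j) → ℂ)) (p.2 l) = 0}
  have hT : ∀ S, IsClosed (T S) := by
    intro S
    simp only [T, productFunctional, dotProduct, Set.ofPred_forall]
    refine isClosed_biInter fun l _ => isClosed_eq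
      (continuous_finsetSum _ fun y _ => (continuous_finsetProd _ fun j _ => ?_).mul
        (by fun_prop)) continuous_const
    exact (continuous_apply (y j)).comp
      (continuous_subtype_val.comp ((continuous_apply j).comp continuous_fst))
  have h : degenerateTuples κ d =
      ⋃ S ∈ {S : Finset κ | S.card = ∑ j, (d j - 1) + 1}, Prod.snd '' T S := by
    ext v
    simp only [degenerateTuples, Set.mem_ofPred_eq, Set.mem_iUnion, exists_prop]
    refine exists_congr fun S => and_congr_right fun _ => ?_
    constructor
    · rintro ⟨φ, hφ, h⟩
      refine ⟨(fun j => ⟨((‖φ j‖⁻¹ : ℝ) : ℂ) • φ j, ?_⟩, v), fun l hl => ?_, rfl⟩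
      · rw [mem_sphere_zero_iff_norm, norm_smul, Complex.norm_real, norm_inv, norm_norm,
          inv_mul_cancel₀ (norm_ne_zero_iff.mpr (hφ j))]
      · change productFunctional (fun j => ((‖φ j‖⁻¹ : ℝ) : ℂ) • φ j) (v l) = 0
        rw [productFunctional_smul_left, h l hl, mul_zero]
    · rintro ⟨⟨φ, w⟩, hp, rfl⟩
      exact ⟨fun j => φ j, fun j => ne_zero_of_mem_unit_sphere (φ j), hp⟩
  rw [h]
  exact (Set.toFinite _).isClosed_biUnion fun S _ => isClosedMap_snd_of_compactSpace _ (hT S)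

/-- The range of a differentiable self-map which is constant in some direction is a null set. -/
theorem addHaar_range_eq_zero_of_const_direction {E : Type*} [NormedAddCommGroup E]
    [NormedSpace ℝ E] [FiniteDimensional ℝ E] [MeasurableSpace E] [BorelSpace E] (μ : Measure E)
    [μ.IsAddHaarMeasure] {f : E → E} (hf : Differentiable ℝ f) {e : E} (he : e ≠ 0)
    (h : ∀ v (t : ℝ), f (v + t • e) = f v) : μ (Set.range f) = 0 := by
  rw [← Set.image_univ]
  refine addHaar_image_eq_zero_of_det_fderivWithin_eq_zero μ
    (fun x _ => (hf x).hasFDerivAt.hasFDerivWithinAt) fun x _ => ?_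
  have h1 : HasDerivAt (fun t : ℝ => f (x + t • e)) (fderiv ℝ f x e) 0 :=
    (hf x).hasFDerivAt.hasLineDerivAt e
  simp only [h] at h1
  have h2 : fderiv ℝ f x e = 0 := h1.unique (hasDerivAt_const _ _)
  change LinearMap.det ((fderiv ℝ f x : E →L[ℝ] E) : E →ₗ[ℝ] E) = 0
  rw [LinearMap.det_eq_zero_iff_ker_ne_bot]
  intro hker
  have : e ∈ LinearMap.ker ((fderiv ℝ f x : E →L[ℝ] E) : E →ₗ[ℝ] E) := h2
  rw [hker] at this
  exact he ((Submodule.mem_bot ℝ).mp this)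

/-- The affine chart of the product functionals which do not vanish at the `x`-th basis vector. -/
def chart {d : ι → ℕ} (x : ∀ j, Fin (d j)) (t : (Σ j, {a : Fin (d j) // a ≠ x j}) → ℂ) (j : ι)
    (a : Fin (d j)) : ℂ :=
  if h : a = x j then 1 else t ⟨j, a, h⟩

/-- The map which solves the equations `productFunctional φ (v l) = 0`, `l ∈ S`, for the
coordinates `v l x`, where `φ` is given in a chart by the old values of these coordinates. -/
def solve [DecidableEq κ] {d : ι → ℕ} (x : ∀ j, Fin (d j)) (S : Finset κ)
    (ε : (Σ j, {a : Fin (d j) // a ≠ x j}) → κ) (v : κ → (∀ j, Fin (d j)) → ℂ) :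
    κ → (∀ j, Fin (d j)) → ℂ := fun l y =>
  if l ∈ S ∧ y = x then
    -∑ z ∈ Finset.univ.erase x, (∏ j, chart x (fun p => v (ε p) x) j (z j)) * v l z
  else v l y

theorem differentiable_solve [DecidableEq κ] {d : ι → ℕ} (x : ∀ j, Fin (d j)) (S : Finset κ)
    (ε : (Σ j, {a : Fin (d j) // a ≠ x j}) → κ) : Differentiable ℝ (solve x S ε) := by
  have hc : ∀ j a, Differentiable ℝ fun v : κ → (∀ j, Fin (d j)) → ℂ =>
      chart x (fun p => v (ε p) x) j a := by
    intro j a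
    by_cases h : a = x j
    · simp only [chart, dif_pos h]; fun_prop
    · simp only [chart, dif_neg h]; fun_prop
  refine differentiable_pi.mpr fun l => differentiable_pi.mpr fun y => ?_
  by_cases h : l ∈ S ∧ y = x
  · simp only [solve, if_pos h]
    fun_prop
  · simp only [solve, if_neg h]
    fun_prop

/-- In a chart, the `N + 1` equations determine the `N + 1` coordinates `v l x`, `l ∈ S`, from the
others and the `N` chart parameters. Storing the parameters in the slots of `S.erase l₀` gives a
self-map of the space that ignores the slot `(l₀, x)`, so its range is null. -/
theorem addHaar_degenerateTuples (d : ι → ℕ)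
    (μ : Measure (κ → (∀ j, Fin (d j)) → ℂ)) [μ.IsAddHaarMeasure] :
    μ (degenerateTuples κ d) = 0 := by
  classical
  have key : ∀ S : Finset κ, S.card = ∑ j, (d j - 1) + 1 → ∀ x : (∀ j, Fin (d j)),
      μ {v | ∃ φ : ∀ j, Fin (d j) → ℂ, (∀ j, φ j (x j) = 1) ∧
        ∀ l ∈ S, productFunctional φ (v l) = 0} = 0 := by
    intro S hS x
    obtain ⟨l₀, hl₀⟩ : S.Nonempty := Finset.card_pos.mp (by omega)
    have hcard : Fintype.card (Σ j, {a : Fin (d j) // a ≠ x j}) =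
        Fintype.card (S.erase l₀ : Finset κ) := by
      rw [Fintype.card_coe, Finset.card_erase_of_mem hl₀, hS]
      simp [Fintype.card_subtype_compl]
    let ε : (Σ j, {a : Fin (d j) // a ≠ x j}) → κ := fun p => (Fintype.equivOfCardEq hcard p : κ)
    have hε : Function.Injective ε :=
      Subtype.val_injective.comp (Fintype.equivOfCardEq hcard).injective
    have hε₀ : ∀ p, ε p ≠ l₀ := fun p =>
      Finset.ne_of_mem_erase (Fintype.equivOfCardEq hcard p).2
    refine measure_mono_null ?_ (addHaar_range_eq_zero_of_const_direction μ
      (differentiable_solve x S ε) (e := Pi.single l₀ (Pi.single x 1)) (by simp) ?_)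
    · rintro v ⟨φ, hφ, h⟩
      have hchart : chart x (fun p => φ p.1 p.2) = φ := by
        ext j a
        by_cases ha : a = x j
        · simp [chart, ha, hφ]
        · simp [chart, ha]
      -- The preimage of `v` carries the chart parameters in the slots `(ε p, x)`; the slot `(l₀,
      -- x)` gets the irrelevant value `0`.
      refine ⟨fun l y => if l ∈ S ∧ y = x then
        Function.extend ε (fun p => φ p.1 p.2) 0 l else v l y, ?_⟩
      ext l y
      by_cases hl : l ∈ S ∧ y = x
      · obtain ⟨hl, rfl⟩ := hl
        have hεS : ∀ p, ε p ∈ S := fun p =>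
          Finset.mem_of_mem_erase (Fintype.equivOfCardEq hcard p).2
        simp only [solve, hl, true_and, if_true, hεS, hε.extend_apply, hchart]
        have := h l hl
        rw [productFunctional, dotProduct, ← Finset.add_sum_erase _ _ (Finset.mem_univ y)] at this
        simp only [hφ, Finset.prod_const_one, one_mul] at this
        rw [eq_comm, eq_neg_iff_add_eq_zero, ← this]
        congr 1
        refine Finset.sum_congr rfl fun z hz => ?_
        rw [if_neg (Finset.ne_of_mem_erase hz)]
      · simp only [solve, if_neg hl]
    · intro v t
      ext l y
      have h1 : ∀ l z, l ≠ l₀ ∨ z ≠ x →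
          (v + t • (Pi.single l₀ (Pi.single x 1) : κ → (∀ j, Fin (d j)) → ℂ)) l z = v l z := by
        rintro l z (h | h)
        · simp [Pi.single_eq_of_ne h]
        · by_cases hl : l = l₀
          · subst hl; simp [Pi.single_eq_of_ne h]
          · simp [Pi.single_eq_of_ne hl]
      simp only [solve, h1 _ x (Or.inl (hε₀ _))]
      split_ifs with hl
      · congr 1
        refine Finset.sum_congr rfl fun z hz => ?_
        rw [h1 _ _ (Or.inr (Finset.ne_of_mem_erase hz))]
      · refine h1 _ _ ?_
        by_contra! hc
        exact hl ⟨hc.1 ▸ hl₀, hc.2⟩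
  refine measure_mono_null (t := ⋃ S ∈ {S : Finset κ | S.card = ∑ j, (d j - 1) + 1},
    ⋃ x : (∀ j, Fin (d j)), {v | ∃ φ : ∀ j, Fin (d j) → ℂ, (∀ j, φ j (x j) = 1) ∧
        ∀ l ∈ S, productFunctional φ (v l) = 0}) ?_ ?_
  · rintro v ⟨S, hS, φ, hφ, h⟩
    choose x hx using fun j => Function.ne_iff.mp (hφ j)
    simp only [Set.mem_iUnion]
    refine ⟨S, hS, x, fun j => (φ j (x j))⁻¹ • φ j, fun j => ?_, fun l hl => ?_⟩
    · simpa using inv_mul_cancel₀ (hx j)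
    · rw [productFunctional_smul_left, h l hl, mul_zero]
  · rw [measure_biUnion_null_iff (Set.to_countable _)]
    intro S hS
    rw [measure_iUnion_null_iff]
    exact key S hS

end Degenerate

/-! ### Null sets of the uniform measure -/

section UnitaryGroup

variable {Y : Type*} [Fintype Y] [DecidableEq Y]

instance : SecondCountableTopology (unitaryGroup Y ℂ) :=
  have : SecondCountableTopology (Matrix Y Y ℂ) :=
    inferInstanceAs (SecondCountableTopology (Y → Y → ℂ))
  TopologicalSpace.Subtype.secondCountableTopology _

variable (Y) in
/-- The Haar probability measure of the unitary group. -/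
abbrev unitaryHaar : Measure (unitaryGroup Y ℂ) :=
  Measure.haarMeasure (⊤ : TopologicalSpace.PositiveCompacts (unitaryGroup Y ℂ))

instance : IsProbabilityMeasure (unitaryHaar Y) :=
  ⟨by simpa using Measure.haarMeasure_self (K₀ := (⊤ : TopologicalSpace.PositiveCompacts
    (unitaryGroup Y ℂ)))⟩

/-- A right translate is again a Haar probability measure, so uniqueness applies. -/
instance : (unitaryHaar Y).IsMulRightInvariant where
  map_mul_right_eq_self g := by
    have : IsProbabilityMeasure (Measure.map (· * g) (unitaryHaar Y)) :=
      Measure.isProbabilityMeasure_map (measurable_mul_const g).aemeasurable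
    exact Measure.isHaarMeasure_eq_of_isProbabilityMeasure _ _

theorem exists_unitary_mulVec_eq (x₀ : Y) {v : Y → ℂ} (hv : v ≠ 0) :
    ∃ (U : unitaryGroup Y ℂ) (r : ℂ), r ≠ 0 ∧ U.1 *ᵥ Pi.single x₀ 1 = r • v := by
  let w : EuclideanSpace ℂ Y := WithLp.toLp 2 v
  have hw : ‖w‖ ≠ 0 := by
    rw [norm_ne_zero_iff]
    intro h
    exact hv (congrArg WithLp.ofLp h)
  have hon : Orthonormal ℂ (({x₀} : Set Y).domRestrict fun _ => ((‖w‖⁻¹ : ℝ) : ℂ) • w) := by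
    rw [orthonormal_subsingleton_iff]
    intro i
    rw [Set.domRestrict_apply, norm_smul, Complex.norm_real, norm_inv, norm_norm, inv_mul_cancel₀ hw]
  obtain ⟨b, hb⟩ := hon.exists_orthonormalBasis_extension_of_card_eq (by simp)
  refine ⟨⟨(EuclideanSpace.basisFun Y ℂ).toBasis.toMatrix b,
    (EuclideanSpace.basisFun Y ℂ).toMatrix_orthonormalBasis_mem_unitary b⟩, ((‖w‖⁻¹ : ℝ) : ℂ),
    by simpa using hw, ?_⟩
  ext y
  have := congrArg (fun u : EuclideanSpace ℂ Y => u y) (hb x₀ rfl)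
  simpa [Module.Basis.toMatrix_apply] using this

theorem unitary_mulVec_injective' (U : unitaryGroup Y ℂ) :
    Function.Injective fun v : Y → ℂ => U.1 *ᵥ v := by
  intro v w h
  have := congrArg (fun z => star U.1 *ᵥ z) h
  simpa only [mulVec_mulVec, U.2.1, one_mulVec] using this

variable {κ : Type*} [Fintype κ]

theorem addHaar_preimage_unitary (μ : Measure (κ → Y → ℂ)) [μ.IsAddHaarMeasure]
    {A : Set (κ → Y → ℂ)} (hA : μ A = 0) (g : κ → unitaryGroup Y ℂ) :
    μ {v | (fun l => (g l).1 *ᵥ v l) ∈ A} = 0 := by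
  let f : (κ → Y → ℂ) →ₗ[ℝ] (κ → Y → ℂ) :=
    LinearMap.pi fun l => ((mulVecLin (g l).1).restrictScalars ℝ).comp (LinearMap.proj l)
  have hf : LinearMap.det f ≠ 0 := by
    rw [Ne, LinearMap.det_eq_zero_iff_ker_ne_bot, not_not, LinearMap.ker_eq_bot]
    intro v w h
    ext1 l
    exact unitary_mulVec_injective' (g l) (congrFun h l)
  have := Measure.addHaar_preimage_linearMap μ hf A
  rw [hA, mul_zero] at this
  exact this

/-- A closed null set of tuples of vectors which is invariant under rescaling of the vectors is
avoided by almost all tuples of images of a fixed basis vector under random unitaries. -/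
theorem ae_unitaryHaar_notMem (μ : Measure (κ → Y → ℂ)) [μ.IsAddHaarMeasure]
    {A : Set (κ → Y → ℂ)} (hA : IsClosed A) (hA0 : μ A = 0)
    (hsmul : ∀ v ∈ A, ∀ r : κ → ℂ, (fun l => r l • v l) ∈ A) (x₀ : Y) :
    ∀ᵐ g ∂(Measure.pi fun _ : κ => unitaryHaar Y),
      (fun l => (g l).1 *ᵥ Pi.single x₀ (1 : ℂ)) ∉ A := by
  have hmeas : MeasurableSet {p : (κ → unitaryGroup Y ℂ) × (κ → Y → ℂ) |
      (fun l => (p.1 l).1 *ᵥ p.2 l) ∉ A} := by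
    refine (hA.isOpen_compl.preimage (continuous_pi fun l => ?_)).measurableSet
    exact Continuous.matrix_mulVec (by fun_prop) (by fun_prop)
  -- Fubini: for each fixed `g` the bad `v` form a null set, as `g` acts by an invertible linear
  -- map.
  have h1 : ∀ᵐ v ∂μ, ∀ᵐ g ∂(Measure.pi fun _ : κ => unitaryHaar Y),
      (fun l => (g l).1 *ᵥ v l) ∉ A := by
    rw [← Measure.ae_ae_comm hmeas]
    refine Filter.Eventually.of_forall fun g => ?_
    rw [ae_iff]
    simpa using addHaar_preimage_unitary μ hA0 g
  have hopen : IsOpen {v : κ → Y → ℂ | ∀ l, v l ≠ 0} := by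
    rw [Set.ofPred_forall]
    exact isOpen_iInter_of_finite fun l => isOpen_ne_fun (continuous_apply l) continuous_const
  -- One good `v` with non-zero entries suffices: up to scalars it is `h` applied to the basis
  -- vector, and right invariance absorbs `h`.
  obtain ⟨v, hv0, hv⟩ := (Measure.dense_of_ae h1).inter_open_nonempty _ hopen
    ⟨fun _ _ => 1, fun l h => one_ne_zero (congrFun h x₀)⟩
  choose h r hr hh using fun l => exists_unitary_mulVec_eq x₀ (hv0 l)
  filter_upwards [(measurePreserving_mul_right (Measure.pi fun _ : κ => unitaryHaar Y)
    h⁻¹).quasiMeasurePreserving.ae hv] with g hg hgA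
  refine hg ?_
  convert hsmul _ hgA fun l => (r l)⁻¹ using 2 with l
  have : v l = (r l)⁻¹ • (h l).1 *ᵥ Pi.single x₀ 1 := by
    rw [hh, smul_smul, inv_mul_cancel₀ (hr l), one_smul]
  rw [this, mulVec_smul, mulVec_mulVec, Pi.mul_apply, Pi.inv_apply, ← Submonoid.coe_mul,
    inv_mul_cancel_right]

end UnitaryGroup

/-! ### Transfer to projective space -/

section Projective

variable {ι κ : Type*} {d : ι → ℕ}

theorem rep_mk_mem_iff {A : Set (κ → (∀ j, Fin (d j)) → ℂ)}
    (hsmul : ∀ v ∈ A, ∀ r : κ → ℂ, (fun l => r l • v l) ∈ A)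
    (v : κ → HilbertSpace d) (hv : ∀ l, v l ≠ 0) :
    (fun l => (Projectivization.mk ℂ (v l) (hv l)).rep.ofLp) ∈ A ↔ (fun l => (v l).ofLp) ∈ A := by
  choose a ha using fun l => Projectivization.exists_smul_eq_mk_rep ℂ (v l) (hv l)
  have h : ∀ l, (Projectivization.mk ℂ (v l) (hv l)).rep.ofLp = (a l : ℂ) • (v l).ofLp :=
    fun l => by rw [← ha l]; rfl
  simp only [h]
  refine ⟨fun hA => ?_, fun hA => hsmul _ hA _⟩
  have := hsmul _ hA fun l => (a l : ℂ)⁻¹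
  simpa only [smul_smul, inv_mul_cancel₀ (a _).ne_zero, one_smul] using this

variable [Fintype ι] [DecidableEq ι]

/-- The projection of the non-zero vectors onto the projective space. -/
def toPureState (v : {v : HilbertSpace d // v ≠ 0}) : PureState d :=
  Projectivization.mk ℂ v.1 v.2

/-- The saturation of an open set is the union of its rescalings. Openness matters because open
quotient maps, unlike general ones, are stable under products, so closedness for tuples of states
can be tested on vectors. -/
theorem isOpenQuotientMap_toPureState : IsOpenQuotientMap (toPureState (d := d)) := by
  have hq : Topology.IsQuotientMap (toPureState (d := d)) := isQuotientMap_quot_mk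
  refine ⟨hq.surjective, hq.continuous, fun U hU => ?_⟩
  rw [← hq.isOpen_preimage]
  have : toPureState ⁻¹' (toPureState '' U) = ⋃ a : ℂˣ, (fun v : {v : HilbertSpace d // v ≠ 0} =>
      (⟨a • v.1, (smul_ne_zero_iff_ne a).mpr v.2⟩ : {v : HilbertSpace d // v ≠ 0})) ⁻¹' U := by
    ext v
    simp only [Set.mem_preimage, Set.mem_image, Set.mem_iUnion]
    constructor
    · rintro ⟨w, hw, hwv⟩
      obtain ⟨a, ha⟩ := (Projectivization.mk_eq_mk_iff ℂ _ _ w.2 v.2).mp hwv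
      refine ⟨a, ?_⟩
      convert hw
    · rintro ⟨a, ha⟩
      exact ⟨_, ha, (Projectivization.mk_eq_mk_iff ℂ _ _ _ v.2).mpr ⟨a, rfl⟩⟩
  rw [this]
  exact isOpen_iUnion fun a =>
    hU.preimage ((continuous_const.smul continuous_subtype_val).subtype_mk _)

instance : SecondCountableTopology (PureState d) :=
  have : SecondCountableTopology {v : HilbertSpace d // v ≠ 0} :=
    TopologicalSpace.Subtype.secondCountableTopology _
  isOpenQuotientMap_toPureState.isQuotientMap.secondCountableTopology
    isOpenQuotientMap_toPureState.isOpenMap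

variable [Fintype κ]

/-- A closed null set of tuples of vectors which is invariant under rescaling of the vectors is
avoided by almost all tuples of pure states. -/
theorem ae_uniformMeasure_rep_notMem [∀ j, NeZero (d j)]
    (μ : Measure (κ → (∀ j, Fin (d j)) → ℂ)) [μ.IsAddHaarMeasure]
    {A : Set (κ → (∀ j, Fin (d j)) → ℂ)} (hA : IsClosed A) (hA0 : μ A = 0)
    (hsmul : ∀ v ∈ A, ∀ r : κ → ℂ, (fun l => r l • v l) ∈ A) :
    ∀ᵐ ψ ∂(Measure.pi fun _ : κ => uniformMeasure d), (fun l => (ψ l).rep.ofLp) ∉ A := by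
  have hclosed : IsClosed {ψ : κ → PureState d | (fun l => (ψ l).rep.ofLp) ∈ A} := by
    rw [← (IsOpenQuotientMap.piMap fun _ : κ =>
      isOpenQuotientMap_toPureState (d := d)).isQuotientMap.isClosed_preimage]
    have : Pi.map (fun _ => toPureState) ⁻¹' {ψ : κ → PureState d | (fun l => (ψ l).rep.ofLp) ∈ A} =
        {v | (fun l => (v l).1.ofLp) ∈ A} := by
      ext v
      exact rep_mk_mem_iff hsmul (fun l => (v l).1) fun l => (v l).2
    rw [this]
    refine hA.preimage (continuous_pi fun l => (PiLp.continuous_ofLp 2 _).comp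
      (continuous_subtype_val.comp (continuous_apply l)))
  have hprob : ∀ _ : κ, IsProbabilityMeasure (Measure.map
      (fun U => unitaryAct U (referenceState d)) (unitaryHaar (∀ j, Fin (d j)))) :=
    fun _ => inferInstanceAs (IsProbabilityMeasure (uniformMeasure d))
  have hmap : (Measure.pi fun _ : κ => uniformMeasure d) =
      (Measure.pi fun _ : κ => unitaryHaar (∀ j, Fin (d j))).map
        fun g l => unitaryAct (g l) (referenceState d) :=
    (Measure.pi_map_pi (f := fun _ U => unitaryAct U (referenceState d))
      fun _ => (continuous_unitaryAct _).measurable.aemeasurable).symm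
  have hcont : Continuous fun (g : κ → unitaryGroup (∀ j, Fin (d j)) ℂ) (l : κ) =>
      unitaryAct (g l) (referenceState d) :=
    continuous_pi fun l => (continuous_unitaryAct _).comp (continuous_apply l)
  have hmeas : MeasurableSet {ψ : κ → PureState d | (fun l => (ψ l).rep.ofLp) ∉ A} :=
    hclosed.measurableSet.compl
  rw [hmap, ae_map_iff hcont.measurable.aemeasurable hmeas]
  filter_upwards [ae_unitaryHaar_notMem μ hA hA0 hsmul 0] with g hg hgA
  exact hg ((rep_mk_mem_iff hsmul _ _).mp hgA)

end Projective

/-! ### Discrimination of generic states from separated copies -/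

section Generic

variable {ι : Type*} [Fintype ι] [DecidableEq ι] {d : ι → ℕ}

theorem productFunctional_tensorPower {c : ℕ} (φ : Fin c → ∀ j, Fin (d j) → ℂ)
    (v : HilbertSpace d) :
    productFunctional (fun p : Fin c × ι => φ p.1 p.2) (tensorPower c v).ofLp =
      ∏ i, productFunctional (φ i) v.ofLp := by
  simp only [productFunctional, dotProduct, Finset.prod_univ_sum, Fintype.piFinset_univ,
    tensorPower, Fintype.prod_prod_type, ← Finset.prod_mul_distrib]
  let e : (∀ p : Fin c × ι, Fin (d p.2)) ≃ (Fin c → ∀ j, Fin (d j)) :=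
    { toFun := fun x i j => x (i, j)
      invFun := fun x p => x p.1 p.2
      left_inv := fun _ => rfl
      right_inv := fun _ => rfl }
  exact Fintype.sum_equiv e _ _ fun _ => rfl

/-- Each of the `c` factors kills at most `N` states by non-degeneracy, so together they cannot kill
the `n - 1 > c * N` states other than `k`. -/
theorem not_unambiguouslyLocallyDistinguishable_separatedCopies {n c : ℕ} (ψ : Fin n → PureState d)
    (hψ : (fun l => (ψ l).rep.ofLp) ∉ degenerateTuples (Fin n) d)
    (hn : 1 + c * ∑ j, (d j - 1) < n) :
    ¬ UnambiguouslyLocallyDistinguishable fun k => (ψ k).separatedCopies c := by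
  intro h
  let k : Fin n := ⟨0, by omega⟩
  obtain ⟨φ', hφ'⟩ := exists_productFunctional_of_unambiguouslyLocallyDistinguishable
    (fun l => tensorPower c (ψ l).rep) (fun l => tensorPower_ne_zero c (ψ l).rep_nonzero) h k
  let φ : Fin c → ∀ j, Fin (d j) → ℂ := fun i j => φ' (i, j)
  have hφ : ∀ l, (∃ i, productFunctional (φ i) (ψ l).rep.ofLp = 0) ↔ l ≠ k := by
    intro l
    rw [← hφ' l]
    change _ ↔ productFunctional (fun p : Fin c × ι => φ p.1 p.2) _ = 0
    simp [productFunctional_tensorPower, Finset.prod_eq_zero_iff]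
  let S : Fin c → Finset (Fin n) := fun i =>
    Finset.univ.filter fun l => productFunctional (φ i) (ψ l).rep.ofLp = 0
  have hS : ∀ i, (S i).card ≤ ∑ j, (d j - 1) := by
    intro i
    by_contra! hlt
    obtain ⟨T, hTS, hT⟩ := Finset.exists_subset_card_eq (Nat.succ_le_of_lt hlt)
    refine hψ ⟨T, hT, φ i, fun j => ?_, fun l hl => (Finset.mem_filter.mp (hTS hl)).2⟩
    exact ne_zero_of_productFunctional_ne_zero (v := (ψ k).rep.ofLp)
      (fun h => (hφ k).mp ⟨i, h⟩ rfl) j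
  have hsub : Finset.univ.erase k ⊆ Finset.univ.biUnion S := by
    intro l hl
    obtain ⟨i, hi⟩ := (hφ l).mpr (Finset.ne_of_mem_erase hl)
    exact Finset.mem_biUnion.mpr ⟨i, Finset.mem_univ i, Finset.mem_filter.mpr ⟨Finset.mem_univ l, hi⟩⟩
  have h1 := (Finset.card_le_card hsub).trans
    (Finset.card_biUnion_le_card_mul _ _ _ fun i _ => hS i)
  rw [Finset.card_erase_of_mem (Finset.mem_univ k)] at h1
  simp only [Finset.card_univ, Fintype.card_fin] at h1
  omega

/-- Split the other `c * N` vectors into `c` blocks of `N` and annihilate each block. A functional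
that also killed `v k` would kill `N + 1` members. This needs full blocks, hence the exact
cardinality. -/
theorem exists_productFunctional_of_notMem_degenerateTuples [∀ j, NeZero (d j)] {κ : Type*}
    [Fintype κ] {c : ℕ} (hκ : Fintype.card κ = 1 + c * ∑ j, (d j - 1))
    {v : κ → (∀ j, Fin (d j)) → ℂ} (hv : v ∉ degenerateTuples κ d) (k : κ) :
    ∃ φ : Fin c → ∀ j, Fin (d j) → ℂ, ∀ l, (∃ i, productFunctional (φ i) (v l) = 0) ↔ l ≠ k := by
  classical
  have hcard : Fintype.card {l // l ≠ k} = Fintype.card (Fin c × Fin (∑ j, (d j - 1))) := by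
    simp [Fintype.card_subtype_compl, hκ]
  let e := Fintype.equivOfCardEq hcard
  choose φ hφ0 hφ using fun i => exists_productFunctional_eq_zero fun m => v (e.symm (i, m))
  refine ⟨φ, fun l => ⟨?_, fun hl => ⟨(e ⟨l, hl⟩).1, ?_⟩⟩⟩
  · rintro ⟨i, hi⟩ rfl
    have hinj : Function.Injective fun m => (e.symm (i, m) : κ) := fun m m' h => by
      simpa using e.symm.injective (Subtype.ext h)
    refine hv ⟨insert l (Finset.univ.image fun m => (e.symm (i, m) : κ)), ?_, φ i, hφ0 i, ?_⟩
    · rw [Finset.card_insert_of_notMem, Finset.card_image_of_injective _ hinj, Finset.card_univ,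
        Fintype.card_fin]
      simp only [Finset.mem_image, Finset.mem_univ, true_and, not_exists]
      exact fun m => (e.symm (i, m)).2
    · intro l' hl'
      rcases Finset.mem_insert.mp hl' with rfl | h
      · exact hi
      · obtain ⟨m, -, rfl⟩ := Finset.mem_image.mp h
        exact hφ i m
  · simpa using hφ (e ⟨l, hl⟩).1 (e ⟨l, hl⟩).2

theorem unambiguouslyLocallyDistinguishable_separatedCopies [Nonempty ι] [∀ j, NeZero (d j)]
    {κ : Type*} [Fintype κ] {c n : ℕ} (hc : 0 < c)
    (hκ : Fintype.card κ = 1 + c * ∑ j, (d j - 1)) (ψ : κ → PureState d)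
    (hψ : (fun l => (ψ l).rep.ofLp) ∉ degenerateTuples κ d) (f : Fin n ↪ κ) :
    UnambiguouslyLocallyDistinguishable fun k => (ψ (f k)).separatedCopies c := by
  have : Nonempty (Fin c × ι) := ⟨⟨0, hc⟩, Classical.arbitrary ι⟩
  refine unambiguouslyLocallyDistinguishable_of_productFunctional
    (fun l => tensorPower c (ψ (f l)).rep) (fun l => tensorPower_ne_zero c (ψ (f l)).rep_nonzero)
    fun k => ?_
  obtain ⟨φ, hφ⟩ := exists_productFunctional_of_notMem_degenerateTuples hκ hψ (f k)
  refine ⟨fun p => φ p.1 p.2, fun l => ?_⟩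
  rw [productFunctional_tensorPower, Finset.prod_eq_zero_iff, ← f.injective.ne_iff, ← hφ]
  simp

theorem ae_rep_notMem_degenerateTuples (κ : Type*) [Fintype κ] (d : ι → ℕ) [∀ j, NeZero (d j)] :
    ∀ᵐ ψ ∂(Measure.pi fun _ : κ => uniformMeasure d),
      (fun l => (ψ l).rep.ofLp) ∉ degenerateTuples κ d :=
  ae_uniformMeasure_rep_notMem Measure.addHaar (isClosed_degenerateTuples d)
    (addHaar_degenerateTuples d _) fun _ hv r => smul_mem_degenerateTuples hv r

theorem ae_unambiguouslyLocallyDistinguishable (d : ι → ℕ) [∀ j, NeZero (d j)] {c n : ℕ}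
    (hc : 0 < c) (hn : n ≤ 1 + c * ∑ j, (d j - 1)) :
    ∀ᵐ ψ ∂(Measure.pi fun _ : Fin n => uniformMeasure d),
      UnambiguouslyLocallyDistinguishable fun k => (ψ k).separatedCopies c := by
  rcases Nat.lt_or_ge 1 n with h1 | h1
  · have : Nonempty ι := by
      by_contra! h
      simp only [Finset.univ_eq_empty, Finset.sum_empty, mul_zero, add_zero] at hn
      omega
    -- Pad to exactly `1 + c * N` states; by Fubini almost every `ψ` extends to a non-degenerate
    -- tuple, and distinguishability passes to the subfamily.
    let κ := Fin n ⊕ Fin (1 + c * ∑ j, (d j - 1) - n)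
    have hκ : Fintype.card κ = 1 + c * ∑ j, (d j - 1) := by
      simp only [κ, Fintype.card_sum, Fintype.card_fin]
      omega
    have h := (measurePreserving_sumPiEquivProdPi_symm
      fun _ : κ => uniformMeasure d).quasiMeasurePreserving.ae (ae_rep_notMem_degenerateTuples κ d)
    filter_upwards [Measure.ae_ae_of_ae_prod h] with ψ hψ
    obtain ⟨ψ', hψ'⟩ := hψ.exists
    exact unambiguouslyLocallyDistinguishable_separatedCopies hc hκ _ hψ' Function.Embedding.inl
  · exact Filter.Eventually.of_forall fun ψ => unambiguouslyLocallyDistinguishable_of_le_one h1 _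

end Generic

end Multipartite

end

theorem mainTheorem6 {ι : Type*} [Fintype ι] [DecidableEq ι] (d : ι → ℕ) [∀ j, NeZero (d j)]
    (c : ℕ) (hc : 0 < c) (n : ℕ) :
    ((∀ᵐ ψ ∂(MeasureTheory.Measure.pi fun _ : Fin n => Multipartite.uniformMeasure d),
        Multipartite.UnambiguouslyLocallyDistinguishable fun k => (ψ k).separatedCopies c) ↔
      n ≤ 1 + c * ∑ j, (d j - 1)) ∧
    (1 + c * ∑ j, (d j - 1) < n →
      ∀ᵐ ψ ∂(MeasureTheory.Measure.pi fun _ : Fin n => Multipartite.uniformMeasure d),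
        ¬ Multipartite.UnambiguouslyLocallyDistinguishable
          fun k => (ψ k).separatedCopies c) := by
  have hnot (hn : 1 + c * ∑ j, (d j - 1) < n) :
      ∀ᵐ ψ ∂(Measure.pi fun _ : Fin n => Multipartite.uniformMeasure d),
        ¬ Multipartite.UnambiguouslyLocallyDistinguishable
          fun k => (ψ k).separatedCopies c := by
    filter_upwards [Multipartite.ae_rep_notMem_degenerateTuples (Fin n) d] with ψ hψ
    exact Multipartite.not_unambiguouslyLocallyDistinguishable_separatedCopies ψ hψ hn
  refine ⟨⟨fun h => ?_, Multipartite.ae_unambiguouslyLocallyDistinguishable d hc⟩, hnot⟩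
  by_contra! hn
  -- The product measure is a probability measure, so two almost sure events share a point.
  obtain ⟨ψ, h1, h2⟩ := (h.and (hnot hn)).exists
  exact h2 h1
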